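/- Let $L$ be a countable first-order language with a distinguished binary relation symbol for an order, and let $T$ be a complete o-minimal $L$-theory: in every model $\mathcal M$ of $T$ the distinguished relation is a linear order (not assumed dense), and every subset of $M$ definable with parameters is a finite union of points and open intervals with endpoints in $M\cup\{\pm\infty\}$. For $n\in\mathbb N$ let $S_n(T)$ be the set of complete $n$-types of $T$ over $\emptyset$; $T$ is called small if $S_n(T)$ is countable for every $n$. A type $p\in S_1(T)$ is called simple if, for every model $\mathcal M$ of $T$ and every nonempty set $B\subseteq M$ of realizations of $p$, every realization of $p$ in $\mathcal M$ that is definable over $B$ belongs to $B$; otherwise $p$ is called nonsimple. Suppose that no $p\in S_1(T)$ is nonsimple. Then $T$ is small if and only if $S_1(T)$ is countable. (Here "countable" means finite or countably infinite.) -/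

import Mathlib

open FirstOrder Set

universe u v w

namespace OMin


/-- Points and open intervals with endpoints in `M ∪ {-∞, +∞}`. -/
def IsPointOrInterval {M : Type w} [LinearOrder M] (s : Set M) : Prop :=
  (∃ a, s = {a}) ∨ (∃ a b, s = Ioo a b) ∨ (∃ a, s = Iio a) ∨ (∃ a, s = Ioi a) ∨ s = univ

/-- A linearly ordered structure is o-minimal if every subset of `M` that is definable with
parameters is a finite union of points and open intervals. -/
def IsOMinimalStructure (L : FirstOrder.Language.{u, v}) (M : Type w) [L.Structure M] [LinearOrder M] : Prop :=
  ∀ s : Set M, (univ : Set M).Definable₁ L s →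
    ∃ F : Set (Set M), F.Finite ∧ (∀ I ∈ F, IsPointOrInterval I) ∧ s = ⋃₀ F

variable {L : FirstOrder.Language.{u, v}}

/-- A theory in an ordered language is o-minimal if the distinguished relation is a linear order
in every model, and every model, with this order, is an o-minimal structure. The order is not
assumed to be dense or without endpoints. -/
structure IsOMinimalTheory [L.IsOrdered] (T : L.Theory) : Prop where
  linearOrder : ∀ φ ∈ L.linearOrderTheory, T ⊨ᵇ φ
  oMinimal : ∀ (M : Type (max u v)) [L.Structure M] [LinearOrder M] [L.OrderedStructure M]
    [Nonempty M] [M ⊨ T], IsOMinimalStructure L M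

/-- The set `S_n(T)` of complete `n`-types of `T` over `∅`. -/
abbrev Types (T : L.Theory) (n : ℕ) := T.CompleteType (Fin n)

/-- `T` is small if `S_n(T)` is countable for every `n`. -/
def IsSmall (T : L.Theory) : Prop :=
  ∀ n : ℕ, Countable (Types T n)

/-- The set `p(M)` of realizations of the 1-type `p` in `M`. -/
def realizations {T : L.Theory} (p : Types T 1) (M : T.ModelType) : Set M :=
  {b | T.typeOf (fun _ : Fin 1 => b) = p}

/-- The set `cl^p(B)` of realizations of `p` in `M` that are definable over `B`. -/
def clType {T : L.Theory} (p : Types T 1) {M : T.ModelType} (B : Set M) : Set M :=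
  {b | b ∈ realizations p M ∧ B.Definable₁ L {b}}

/-- A type `p ∈ S_1(T)` is simple if `cl^p(B) = B` for every nonempty set `B` of realizations of
`p`, in any model of `T`. (Nonemptiness of `B` only matters when `p` is the type of an
`∅`-definable element.) -/
def IsSimple {T : L.Theory} (p : Types T 1) : Prop :=
  ∀ (M : FirstOrder.Language.Theory.ModelType.{u, v, max u v} T) (B : Set M),
    B.Nonempty → B ⊆ realizations p M → clType p B = B

/-- `T` admits a nonsimple type (over `∅`). -/
def AdmitsNonsimpleType (T : L.Theory) : Prop :=
  ∃ p : Types T 1, ¬ IsSimple p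

end OMin

/-!
Write `dcl A` for the elements of a model definable over `A`. The argument bounds, for a tuple `a`
and a type `p ∈ S_1(T)`, the number of types over `a` of realizations of `p`.

*Exchange holds in every o-minimal structure, dense or not* (`IsOMinimalStructure.exchange`), and
the monotonicity theorem is not needed. Let `c = f a` with `f` definable over `A`, and suppose that
`a` is not definable over `A ∪ {c}`. The convex part of the fibre of `c` around `a` is definable
over `A ∪ {c}`, hence `a` is neither its maximum nor its minimum, and `a` is interior to an interval
on which `f` is constant. The set `Q` of all points with this property is definable over `A`, so it
is a finite union of convex sets, and `f` is constant on each of them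
(`IsOMinimalStructure.const_of_locally_const`): an initial segment of constancy has an endpoint
(`IsOMinimalStructure.lowerSet_eq`), and `f` is constant around that endpoint too. So `f` takes
finitely many values on `Q`, and they, `c` among them, are definable over `A`.

*Simplicity bounds the number of realizations of `p` in `dcl a`.* A set of at least two realizations
of a simple type is independent for `dcl`, so by exchange `dcl a` contains only finitely many
realizations of `p` (`IsSimple.finite_dcl_inter`).

*Types over a tuple are cuts.* By o-minimality the type of `b` over `a` is determined by the cut of
`b` in `dcl a`. The points of `dcl a` that do not realize the type `p` of `b` are separated from `b`
by formulas in `p`, so `p` and the position of `b` among the finitely many realizations of `p` in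
`dcl a` suffice. That position is expressed by one formula `φ (x, y)`
(`IsOMinimalStructure.exists_isolating`, `IsOMinimalTheory.exists_isolates`). Hence the type of
`(a, b)` is determined by the types of `a` and of `b` and by `φ`, and `S_{n+1}(T)` embeds into
`S_n(T) × S_1(T) × {formulas}`, which is countable if `S_n(T)` and `S_1(T)` are.
-/

namespace OMin

variable {L : FirstOrder.Language.{u, v}} {M : Type w} [L.Structure M]

/-! ### A calculus of definable predicates -/

section Calculus

variable {A : Set M} {α : Type*}

theorem definable_and {P Q : (α → M) → Prop} (hP : A.Definable L {w | P w})
    (hQ : A.Definable L {w | Q w}) : A.Definable L {w | P w ∧ Q w} :=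
  hP.inter hQ

theorem definable_not {P : (α → M) → Prop} (hP : A.Definable L {w | P w}) :
    A.Definable L {w | ¬ P w} :=
  hP.compl

theorem definable_imp {P Q : (α → M) → Prop} (hP : A.Definable L {w | P w})
    (hQ : A.Definable L {w | Q w}) : A.Definable L {w | P w → Q w} := by
  convert definable_not (definable_and hP (definable_not hQ)) using 2
  simp

theorem definable_exists [Finite α] {P : M → (α → M) → Prop}
    (hP : A.Definable L {w : Option α → M | P (w none) (fun i => w (some i))}) :
    A.Definable L {w : α → M | ∃ y, P y w} := by
  convert hP.image_comp (some : α → Option α) using 1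
  ext w
  constructor
  · rintro ⟨y, hy⟩
    exact ⟨fun o => o.elim y w, hy, rfl⟩
  · rintro ⟨w', hw', rfl⟩
    exact ⟨w' none, hw'⟩

theorem definable_forall [Finite α] {P : M → (α → M) → Prop}
    (hP : A.Definable L {w : Option α → M | P (w none) (fun i => w (some i))}) :
    A.Definable L {w : α → M | ∀ y, P y w} := by
  convert definable_not (definable_exists (P := fun y w => ¬ P y w) (definable_not hP)) using 2
  simp

/-- A binary relation on `M` is definable over `A`. -/
def DefRel (L : FirstOrder.Language.{u, v}) [L.Structure M] (A : Set M) (R : M → M → Prop) :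
    Prop :=
  A.Definable L {w : Fin 2 → M | R (w 0) (w 1)}

theorem definable_mem {S : Set M} (hS : A.Definable₁ L S) (i : α) :
    A.Definable L {w : α → M | w i ∈ S} :=
  hS.preimage_comp (fun _ => i)

theorem definable_rel {R : M → M → Prop} (hR : DefRel L A R) (i j : α) :
    A.Definable L {w : α → M | R (w i) (w j)} := by
  have h := Set.Definable.preimage_comp ![i, j] hR
  exact h

theorem definable_eq (i j : α) : A.Definable L {w : α → M | w i = w j} :=
  definable_rel (R := fun x y => x = y) (Set.Definable.diagonal L A) i j

variable [L.IsOrdered] [LinearOrder M] [L.OrderedStructure M]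

theorem definable_le (i j : α) : A.Definable L {w : α → M | w i ≤ w j} := by
  refine Set.Definable.mono (A := ∅) ?_ (empty_subset _)
  refine Set.empty_definable_iff.2 ⟨Language.leSymb.formula₂
    (Language.Term.var i) (Language.Term.var j), ?_⟩
  ext w
  simp [Language.Formula.realize_rel₂, Language.Term.realize_var]

theorem definable_lt (i j : α) : A.Definable L {w : α → M | w i < w j} := by
  convert definable_not (definable_le (L := L) (A := A) j i) using 2
  simp

end Calculus

/-! ### Parameters and the definable closure -/

section Parameters

variable {A : Set M}

/-- Definability over `A` with one more parameter is definability of a section of a relation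
over `A`. -/
theorem definable₁_insert_iff {a : M} {S : Set M} :
    (insert a A).Definable₁ L S ↔ ∃ R, DefRel L A R ∧ S = {y | R y a} := by
  classical
  constructor
  · intro h
    obtain ⟨φ, hφ⟩ := Set.definable_iff_exists_formula_sum.1 h
    -- rename the parameter `a` to a second variable
    let g : (insert a A : Set M) ⊕ Fin 1 → A ⊕ Fin 2 := fun s =>
      Sum.elim (fun x : (insert a A : Set M) =>
          if hx : (x : M) ∈ A then Sum.inl ⟨x, hx⟩ else Sum.inr 1)
        (fun _ => Sum.inr 0) s
    have key : ∀ w : Fin 2 → M, w 1 = a →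
        (Sum.elim (fun x : A => (x : M)) w) ∘ g
          = Sum.elim (fun x : (insert a A : Set M) => (x : M)) (fun _ : Fin 1 => w 0) := by
      intro w hw
      funext s
      rcases s with ⟨x, hx⟩ | i
      · by_cases hxA : x ∈ A
        · simp [g, hxA]
        · have : x = a := by simpa [hxA] using hx
          subst this
          simp [g, hxA, hw]
      · simp [g]
    refine ⟨fun y x => (φ.relabel g).Realize (Sum.elim (fun x : A => (x : M)) ![y, x]), ?_, ?_⟩
    · refine Set.definable_iff_exists_formula_sum.2 ⟨φ.relabel g, ?_⟩
      ext w
      have : ![w 0, w 1] = w := by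
        ext i; fin_cases i <;> rfl
      simp only [mem_ofPred_eq, this]
    · ext y
      have h1 : (fun _ : Fin 1 => y) ∈ {x : Fin 1 → M | x 0 ∈ S} ↔ y ∈ S := Iff.rfl
      rw [← h1, hφ]
      simp only [mem_ofPred_eq, Language.Formula.realize_relabel]
      rw [key _ rfl]
      rfl
  · rintro ⟨R, hR, rfl⟩
    have hR' : DefRel L (insert a A) R := Set.Definable.mono hR (subset_insert _ _)
    have ha : (insert a A).Definable₁ L {a} :=
      Set.Definable.singleton_of_mem L (mem_insert _ _)
    have : (insert a A).Definable L {w : Fin 1 → M | ∃ z, z ∈ ({a} : Set M) ∧ R (w 0) z} :=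
      definable_exists (definable_and (definable_mem ha _) (definable_rel hR' _ _))
    simp only [mem_singleton_iff, exists_eq_left] at this
    exact this

/-- The definable closure of a set of parameters. -/
def dcl (L : FirstOrder.Language.{u, v}) [L.Structure M] (A : Set M) : Set M :=
  {c | A.Definable₁ L {c}}

theorem dcl_mono {B : Set M} (h : A ⊆ B) : dcl L A ⊆ dcl L B := fun _ hc =>
  Set.Definable.mono hc h

/-- A parameter in the definable closure of the others can be dropped. -/
theorem definable₁_of_insert {a : M} (ha : a ∈ dcl L A) {S : Set M}
    (hS : (insert a A).Definable₁ L S) : A.Definable₁ L S := by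
  obtain ⟨R, hR, rfl⟩ := definable₁_insert_iff.1 hS
  have : A.Definable L {w : Fin 1 → M | ∃ z, z ∈ ({a} : Set M) ∧ R (w 0) z} :=
    definable_exists (definable_and (definable_mem ha _) (definable_rel hR _ _))
  simp only [mem_singleton_iff, exists_eq_left] at this
  exact this

/-- The exchange property implies that a finite independent subset of the definable closure of
`K ∪ A` has at most as many elements as `A`. -/
theorem card_le_of_exchange
    (exch : ∀ (A : Set M) (a c : M), c ∈ dcl L (insert a A) → c ∉ dcl L A →
      a ∈ dcl L (insert c A)) (A : Finset M) :
    ∀ (K : Set M) (B : Finset M), (∀ b ∈ B, b ∈ dcl L (K ∪ A)) →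
      (∀ b ∈ B, b ∉ dcl L (K ∪ (B \ {b} : Set M))) → B.card ≤ A.card := by
  classical
  induction A using Finset.induction_on with
  | empty =>
    intro K B hB hind
    have : B = ∅ := by
      refine Finset.eq_empty_of_forall_notMem fun b hb => hind b hb ?_
      exact dcl_mono (by simp) (hB b hb)
    simp [this]
  | insert a A ha ih =>
    intro K B hB hind
    rw [Finset.card_insert_of_notMem ha]
    by_cases h : ∀ b ∈ B, b ∈ dcl L (K ∪ A)
    · exact (ih K B h hind).trans (Nat.le_succ _)
    push Not at h
    obtain ⟨b, hb, hbA⟩ := h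
    have e1 : K ∪ ((insert a A : Finset M) : Set M) = insert a (K ∪ A) := by
      rw [Finset.coe_insert, union_insert]
    have hab : a ∈ dcl L (insert b (K ∪ A)) := exch _ a b (e1 ▸ hB b hb) hbA
    have := ih (insert b K) (B.erase b) ?_ ?_
    · rw [Finset.card_erase_of_mem hb] at this
      omega
    · intro c hc
      have hc' := hB c (Finset.mem_of_mem_erase hc)
      rw [e1] at hc'
      rw [insert_union]
      exact definable₁_of_insert hab
        (dcl_mono (insert_subset_insert (subset_insert _ _)) hc')
    · intro c hc hc'
      refine hind c (Finset.mem_of_mem_erase hc) (dcl_mono ?_ hc')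
      have hne := Finset.ne_of_mem_erase hc
      intro x hx
      simp only [mem_union, mem_insert_iff, mem_sdiff, Finset.coe_erase, Finset.mem_coe,
        mem_singleton_iff] at hx ⊢
      rcases hx with (rfl | hx) | ⟨⟨hx, _⟩, hx2⟩
      · exact Or.inr ⟨hb, fun h => hne h.symm⟩
      · exact Or.inl hx
      · exact Or.inr ⟨hx, hx2⟩

end Parameters

/-! ### Definable sets in an o-minimal structure -/

section OMinimal

variable [LinearOrder M] {A : Set M}

theorem IsPointOrInterval.ordConnected {s : Set M} (h : IsPointOrInterval s) :
    s.OrdConnected := by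
  rcases h with ⟨a, rfl⟩ | ⟨a, b, rfl⟩ | ⟨a, rfl⟩ | ⟨a, rfl⟩ | rfl <;> infer_instance

theorem IsOMinimalStructure.exists_cover (hM : IsOMinimalStructure L M) {S : Set M}
    (hS : A.Definable₁ L S) :
    ∃ F : Set (Set M), F.Finite ∧ (∀ I ∈ F, IsPointOrInterval I) ∧ S = ⋃₀ F :=
  hM S (Set.Definable.mono hS (subset_univ _))

variable [L.IsOrdered] [L.OrderedStructure M]

/-- The points `y` such that at least `k` times, going up to `y`, one leaves the set `S`. -/
def exitsBelow (S : Set M) : ℕ → Set M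
  | 0 => univ
  | k + 1 => {y | ∃ x, x ≤ y ∧ x ∉ S ∧ ∃ z, z ≤ x ∧ z ∈ S ∧ z ∈ exitsBelow S k}

theorem exitsBelow_definable {S : Set M} (hS : A.Definable₁ L S) (k : ℕ) :
    A.Definable₁ L (exitsBelow S k) := by
  induction k with
  | zero => exact Set.definable_univ
  | succ k ih =>
    exact definable_exists (definable_and (definable_le _ _)
      (definable_and (definable_not (definable_mem hS _))
        (definable_exists (definable_and (definable_le _ _)
          (definable_and (definable_mem hS _) (definable_mem ih _))))))

theorem exitsBelow_isUpperSet (S : Set M) (k : ℕ) : IsUpperSet (exitsBelow S k) := by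
  cases k with
  | zero => exact isUpperSet_univ
  | succ k => exact fun y y' h ⟨x, hx, h2⟩ => ⟨x, hx.trans h, h2⟩

/-- Distinct exits from a union of convex sets are exits from distinct members. -/
theorem le_ncard_of_mem_exitsBelow {F : Set (Set M)} (hF : F.Finite)
    (hconv : ∀ J ∈ F, J.OrdConnected) (k : ℕ) (y : M) (hy : y ∈ exitsBelow (⋃₀ F) k) :
    k ≤ {J ∈ F | ∃ z ∈ J, ∃ x, z ≤ x ∧ x ≤ y ∧ x ∉ ⋃₀ F}.ncard := by
  induction k generalizing y with
  | zero => exact Nat.zero_le _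
  | succ k ih =>
    obtain ⟨x, hxy, hx, z, hzx, ⟨J, hJ, hzJ⟩, hz⟩ := hy
    refine (Nat.succ_le_succ (ih z hz)).trans (Nat.succ_le_of_lt ?_)
    refine Set.ncard_lt_ncard ?_ (hF.subset (sep_subset _ _))
    refine (ssubset_iff_of_subset ?_).2 ⟨J, ⟨hJ, z, hzJ, x, hzx, hxy, hx⟩, ?_⟩
    · rintro J' ⟨hJ', z', hz', x', h1, h2, h3⟩
      exact ⟨hJ', z', hz', x', h1, h2.trans (hzx.trans hxy), h3⟩
    · rintro ⟨-, z', hz', x', h1, h2, h3⟩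
      exact h3 ⟨J, hJ, (hconv J hJ).out hz' hzJ ⟨h1, h2⟩⟩

/-- Every point of a definable set lies in a convex part which is definable over the same
parameters: the points of the set with the same number of exits below. -/
theorem IsOMinimalStructure.exists_ordConnected (hM : IsOMinimalStructure L M) {S : Set M}
    (hS : A.Definable₁ L S) {b : M} (hb : b ∈ S) :
    ∃ C, A.Definable₁ L C ∧ C.OrdConnected ∧ b ∈ C ∧ C ⊆ S := by
  classical
  obtain ⟨F, hF, hFI, hSF⟩ := hM.exists_cover hS
  have hex : ∃ k, b ∉ exitsBelow S k := by
    by_contra! h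
    have h1 := le_ncard_of_mem_exitsBelow hF (fun J hJ => (hFI J hJ).ordConnected)
      (F.ncard + 1) b (hSF ▸ h _)
    have h2 := Set.ncard_le_ncard (sep_subset F
      (fun J => ∃ z ∈ J, ∃ x, z ≤ x ∧ x ≤ b ∧ x ∉ ⋃₀ F)) hF
    exact absurd (h1.trans h2) (by simp)
  obtain ⟨k, hk, hk'⟩ : ∃ k, b ∈ exitsBelow S k ∧ b ∉ exitsBelow S (k + 1) := by
    by_contra! h
    obtain ⟨k, hk⟩ := hex
    exact hk (Nat.rec (mem_univ b) h k)
  refine ⟨{y | y ∈ S ∧ y ∈ exitsBelow S k ∧ y ∉ exitsBelow S (k + 1)}, ?_, ⟨?_⟩,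
    ⟨hb, hk, hk'⟩, fun y hy => hy.1⟩
  · exact definable_and (definable_mem hS _) (definable_and
      (definable_mem (exitsBelow_definable hS k) _)
      (definable_not (definable_mem (exitsBelow_definable hS (k + 1)) _)))
  · rintro x ⟨hx, hxk, hxk'⟩ y ⟨hy, hyk, hyk'⟩ z ⟨hxz, hzy⟩
    refine ⟨?_, exitsBelow_isUpperSet S k hxz hxk,
      fun h => hyk' (exitsBelow_isUpperSet S (k + 1) hzy h)⟩
    by_contra hz
    exact hyk' ⟨z, hzy, hz, x, hxz, hx, hxk⟩

/-- The maximum of a definable set is definable over the same parameters. -/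
theorem isGreatest_mem_dcl {S : Set M} (hS : A.Definable₁ L S) {e : M} (he : IsGreatest S e) :
    e ∈ dcl L A := by
  have h : A.Definable L {w : Fin 1 → M | w 0 ∈ S ∧ ∀ z, z ∈ S → z ≤ w 0} :=
    definable_and (definable_mem hS _)
      (definable_forall (definable_imp (definable_mem hS _) (definable_le _ _)))
  have : ({e} : Set M) = {y | y ∈ S ∧ ∀ z, z ∈ S → z ≤ y} := by
    ext y
    exact ⟨fun hy => by rw [mem_singleton_iff.1 hy]; exact ⟨he.1, he.2⟩,
      fun hy => IsGreatest.unique (a := y) ⟨hy.1, hy.2⟩ he⟩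
  change A.Definable₁ L {e}
  rw [this]
  exact h

/-- The minimum of a definable set is definable over the same parameters. -/
theorem isLeast_mem_dcl {S : Set M} (hS : A.Definable₁ L S) {e : M} (he : IsLeast S e) :
    e ∈ dcl L A := by
  have h : A.Definable L {w : Fin 1 → M | w 0 ∈ S ∧ ∀ z, z ∈ S → w 0 ≤ z} :=
    definable_and (definable_mem hS _)
      (definable_forall (definable_imp (definable_mem hS _) (definable_le _ _)))
  have : ({e} : Set M) = {y | y ∈ S ∧ ∀ z, z ∈ S → y ≤ z} := by
    ext y
    exact ⟨fun hy => by rw [mem_singleton_iff.1 hy]; exact ⟨he.1, he.2⟩,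
      fun hy => IsLeast.unique (a := y) ⟨hy.1, hy.2⟩ he⟩
  change A.Definable₁ L {e}
  rw [this]
  exact h

/-- The elements of a finite definable set are definable over the same parameters. -/
theorem finite_subset_dcl {S : Set M} (hfin : S.Finite) (hS : A.Definable₁ L S) :
    S ⊆ dcl L A := by
  induction h : S.ncard generalizing S with
  | zero =>
    rw [(Set.ncard_eq_zero hfin).1 h]
    exact empty_subset _
  | succ n ih =>
    have hne : S.Nonempty := Set.nonempty_of_ncard_ne_zero (by omega)
    obtain ⟨m, hm, hmin⟩ := hfin.exists_minimalFor id S hne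
    have hle : IsLeast S m := ⟨hm, fun z hz => (le_total m z).elim id (hmin hz)⟩
    have hmd := isLeast_mem_dcl hS hle
    have h1 := ih (hfin.sdiff (t := {m})) (Set.Definable.sdiff hS hmd) (by
      rw [Set.ncard_sdiff_singleton_of_mem hm, h]; rfl)
    intro x hx
    by_cases hxm : x = m
    · exact hxm ▸ hmd
    · exact h1 ⟨hx, hxm⟩

/-- A definable initial segment is determined by an endpoint in the definable closure of the
parameters; the order need not be dense or complete. -/
theorem IsOMinimalStructure.lowerSet_eq (hM : IsOMinimalStructure L M) {I : Set M}
    (hI : A.Definable₁ L I) (hlow : IsLowerSet I) :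
    I = ∅ ∨ I = univ ∨ ∃ e ∈ dcl L A, I = Iic e ∨ I = Iio e := by
  classical
  rcases I.eq_empty_or_nonempty with rfl | ⟨x0, hx0⟩
  · exact Or.inl rfl
  right
  obtain ⟨F, hF, hFI, hIF⟩ := hM.exists_cover hI
  -- some member `J` of the finite cover is cofinal in `I`
  obtain ⟨J, hJ, hcof⟩ : ∃ J ∈ F, ∀ x ∈ I, ∃ y ∈ J, x ≤ y := by
    have : Nonempty M := ⟨x0⟩
    by_contra! h
    choose! f hf using h
    obtain ⟨J0, hJ0, -⟩ := hIF ▸ hx0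
    obtain ⟨J1, hJ1, hmax⟩ := hF.exists_maximalFor f F ⟨J0, hJ0⟩
    obtain ⟨J2, hJ2, hx⟩ := hIF ▸ (hf J1 hJ1).1
    have h1 := (hf J2 hJ2).2 _ hx
    exact absurd (hmax hJ2 h1.le) (not_le.2 h1)
  have hJI : J ⊆ I := fun y hy => hIF ▸ ⟨J, hJ, hy⟩
  obtain ⟨j, hj, -⟩ := hcof x0 hx0
  have key : ∀ b, (∀ y ∈ J, y < b) → (∀ z, j ≤ z → z < b → z ∈ J) →
      I = univ ∨ ∃ e ∈ dcl L A, I = Iic e ∨ I = Iio e := by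
    intro b h1 h2
    have hIio : I = Iio b := by
      ext z
      constructor
      · intro hz
        obtain ⟨y, hy, hzy⟩ := hcof z hz
        exact hzy.trans_lt (h1 y hy)
      · intro hz
        rcases le_total j z with h | h
        · exact hJI (h2 z h hz)
        · exact hlow h (hJI hj)
    refine Or.inr ⟨b, isLeast_mem_dcl (S := Iᶜ) (Set.Definable.compl hI) ?_, Or.inr hIio⟩
    rw [hIio, compl_Iio]
    exact isLeast_Ici
  rcases hFI J hJ with ⟨a, rfl⟩ | ⟨a, b, rfl⟩ | ⟨a, rfl⟩ | ⟨a, rfl⟩ | rfl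
  · have hIic : I = Iic a := by
      ext z
      constructor
      · intro hz
        obtain ⟨y, rfl, hzy⟩ := hcof z hz
        exact hzy
      · intro hz
        exact hlow hz (hJI rfl)
    refine Or.inr ⟨a, isGreatest_mem_dcl hI ?_, Or.inl hIic⟩
    rw [hIic]
    exact isGreatest_Iic
  · exact key b (fun y hy => hy.2) (fun z h1 h2 => ⟨hj.1.trans_le h1, h2⟩)
  · exact key a (fun y hy => hy) (fun z h1 h2 => h2)
  · refine Or.inl (eq_univ_of_forall fun z => ?_)
    rcases le_total j z with h | h
    · exact hJI (lt_of_lt_of_le hj h)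
    · exact hlow h (hJI hj)
  · exact Or.inl (univ_subset_iff.1 hJI)

/-! ### Exchange for the definable closure -/

/-- Let `G` be the graph of a definable partial function. On a convex set each of whose points is
interior to an interval of constancy, the function is constant. -/
theorem IsOMinimalStructure.const_of_locally_const (hM : IsOMinimalStructure L M)
    {G : M → M → Prop} (hG : DefRel L A G) (hfun : ∀ x y y', G x y → G x y' → y = y')
    {J : Set M} (hJ : J.OrdConnected)
    (hloc : ∀ x ∈ J, ∃ y t s, t < x ∧ x < s ∧ ∀ r, t ≤ r → r ≤ s → G r y)
    {x x' y : M} (hx : x ∈ J) (hx' : x' ∈ J) (hxx' : x ≤ x') (hy : G x y) : G x' y := by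
  -- the initial segment generated by the points up to which the function is constant from `x` on
  let I : Set M := {t | ∃ z, t ≤ z ∧ x ≤ z ∧ ∀ r, x ≤ r → r ≤ z → G r y}
  have hlow : IsLowerSet I := fun a b hba ⟨z, hz, h⟩ => ⟨z, hba.trans hz, h⟩
  have hxI : x ∈ I := ⟨x, le_rfl, le_rfl, fun r h1 h2 => le_antisymm h2 h1 ▸ hy⟩
  have hI : (univ : Set M).Definable₁ L I := by
    have hs : ∀ c : M, (univ : Set M).Definable₁ L {c} := fun c =>
      Set.Definable.singleton_of_mem L (mem_univ c)
    have hG' : DefRel L univ G := Set.Definable.mono hG (subset_univ _)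
    have : (univ : Set M).Definable L {w : Fin 1 → M | ∃ p, p ∈ ({x} : Set M) ∧
        ∃ q, q ∈ ({y} : Set M) ∧ ∃ z, w 0 ≤ z ∧ p ≤ z ∧ ∀ r, p ≤ r → r ≤ z → G r q} :=
      definable_exists (definable_and (definable_mem (hs x) _)
        (definable_exists (definable_and (definable_mem (hs y) _)
          (definable_exists (definable_and (definable_le _ _) (definable_and (definable_le _ _)
            (definable_forall (definable_imp (definable_le _ _)
              (definable_imp (definable_le _ _) (definable_rel hG' _ _))))))))))
    simp only [mem_singleton_iff, exists_eq_left] at this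
    exact this
  have hmem : x' ∈ I → G x' y := fun ⟨z, h1, _, h2⟩ => h2 x' hxx' h1
  by_contra hcon
  rcases hM.lowerSet_eq hI hlow with h0 | h0 | ⟨e, -, h0⟩
  · exact absurd (h0 ▸ hxI) (notMem_empty x)
  · exact hcon (hmem (h0 ▸ mem_univ x'))
  have hx'I : x' ∉ I := fun h => hcon (hmem h)
  have hxe : x ≤ e := by
    rcases h0 with h0 | h0
    · exact (h0 ▸ hxI : x ∈ Iic e)
    · exact (h0 ▸ hxI : x ∈ Iio e).le
  have hex' : e ≤ x' := by
    rcases h0 with h0 | h0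
    · exact (not_le.1 fun h => hx'I (h0 ▸ h)).le
    · exact not_lt.1 fun h => hx'I (h0 ▸ h)
  -- the function is constant on both sides of the endpoint `e` of the segment
  obtain ⟨y', t, s, hte, hes, hts⟩ := hloc e (hJ.out hx hx' ⟨hxe, hex'⟩)
  rcases h0 with h0 | h0
  · obtain ⟨z, hez, hxz, hz⟩ : e ∈ I := h0 ▸ self_mem_Iic
    have hyy : y = y' := hfun e _ _ (hz e hxe hez) (hts e hte.le hes.le)
    have : s ∈ I := ⟨s, le_rfl, hxe.trans hes.le, fun r h1 h2 => by
      rcases le_total r e with h | h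
      · exact hz r h1 (h.trans hez)
      · exact hyy ▸ hts r (hte.le.trans h) h2⟩
    exact absurd (h0 ▸ this : s ∈ Iic e) (not_le.2 hes)
  · obtain ⟨z, htz, hxz, hz⟩ : t ∈ I := h0 ▸ hte
    have hze : z < e := (h0 ▸ (⟨z, le_rfl, hxz, hz⟩ : z ∈ I) : z ∈ Iio e)
    have hyy : y = y' := hfun z _ _ (hz z hxz le_rfl) (hts z htz (hze.le.trans hes.le))
    have : e ∈ I := ⟨e, le_rfl, hxe, fun r h1 h2 => by
      rcases le_total r z with h | h
      · exact hz r h1 h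
      · exact hyy ▸ hts r (htz.trans h) (h2.trans hes.le)⟩
    exact absurd (h0 ▸ this : e ∈ Iio e) (lt_irrefl e)

/-- The exchange property. If `c = f a` for an `A`-definable partial function `f` and `a` is not
definable over `A ∪ {c}`, then `a` is interior to an interval on which `f` takes the value `c`.
Only finitely many values are taken on intervals, so `c` is definable over `A`. -/
theorem IsOMinimalStructure.exchange (hM : IsOMinimalStructure L M) (A : Set M) (a c : M)
    (hc : c ∈ dcl L (insert a A)) (hcA : c ∉ dcl L A) : a ∈ dcl L (insert c A) := by
  by_contra ha
  obtain ⟨R, hR, hRc⟩ := definable₁_insert_iff.1 hc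
  let G : M → M → Prop := fun x y => R y x ∧ ∀ y', R y' x → y' = y
  have hG : DefRel L A G := definable_and (definable_rel hR _ _)
    (definable_forall (definable_imp (definable_rel hR _ _) (definable_eq _ _)))
  have hfun : ∀ x y y', G x y → G x y' → y = y' := fun x y y' h h' => h'.2 y h.1
  have hR1 : ∀ y, R y a ↔ y = c := fun y => by
    have : y ∈ {y | R y a} ↔ y = c := by rw [← hRc]; rfl
    exact this
  have hac : G a c := ⟨(hR1 c).2 rfl, fun y' h => (hR1 y').1 h⟩
  -- a convex part of the fibre of `c` around `a`
  have hfib : (insert c A).Definable₁ L {x | G x c} :=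
    definable₁_insert_iff.2 ⟨G, hG, rfl⟩
  obtain ⟨C, hC, hCc, haC, hCG⟩ := hM.exists_ordConnected hfib hac
  obtain ⟨s, hsC, has⟩ : ∃ s ∈ C, a < s := by
    by_contra! h
    exact ha (isGreatest_mem_dcl hC ⟨haC, h⟩)
  obtain ⟨t, htC, hta⟩ : ∃ t ∈ C, t < a := by
    by_contra! h
    exact ha (isLeast_mem_dcl hC ⟨haC, h⟩)
  -- the points interior to intervals of constancy, and the values taken there
  let Q : Set M := {x | ∃ y t s, t < x ∧ x < s ∧ ∀ r, t ≤ r → r ≤ s → G r y}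
  have hQ : A.Definable₁ L Q :=
    definable_exists (definable_exists (definable_exists (definable_and (definable_lt _ _)
      (definable_and (definable_lt _ _) (definable_forall (definable_imp (definable_le _ _)
        (definable_imp (definable_le _ _) (definable_rel hG _ _))))))))
  let Y : Set M := {y | ∃ x, x ∈ Q ∧ G x y}
  have hY : A.Definable₁ L Y :=
    definable_exists (definable_and (definable_mem hQ _) (definable_rel hG _ _))
  have hcY : c ∈ Y :=
    ⟨a, ⟨c, t, s, hta, has, fun r h1 h2 => hCG (hCc.out htC hsC ⟨h1, h2⟩)⟩, hac⟩
  refine hcA (finite_subset_dcl ?_ hY hcY)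
  obtain ⟨F, hF, hFI, hQF⟩ := hM.exists_cover hQ
  have hsub : Y ⊆ ⋃ J ∈ F, {y | ∃ x ∈ J, G x y} := by
    rintro y ⟨x, hx, hxy⟩
    obtain ⟨J, hJ, hxJ⟩ := hQF ▸ hx
    exact mem_biUnion hJ ⟨x, hxJ, hxy⟩
  refine (hF.biUnion fun J hJ => ?_).subset hsub
  refine Set.Subsingleton.finite ?_
  rintro y ⟨x, hx, hxy⟩ y' ⟨x', hx', hxy'⟩
  have hJQ : ∀ z ∈ J, z ∈ Q := fun z hz => hQF ▸ ⟨J, hJ, hz⟩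
  have hconv := (hFI J hJ).ordConnected
  rcases le_total x x' with h | h
  · exact hfun x' _ _ (hM.const_of_locally_const hG hfun hconv hJQ hx hx' h hxy) hxy'
  · exact hfun x _ _ hxy (hM.const_of_locally_const hG hfun hconv hJQ hx' hx h hxy')

end OMinimal

/-! ### Isolating a type over a tuple modulo a one-type -/

section Isolation

variable [LinearOrder M] {A : Set M} [L.IsOrdered] [L.OrderedStructure M]

theorem definable₁_Ioi {e : M} (he : e ∈ dcl L A) : A.Definable₁ L {y | e < y} := by
  have : A.Definable L {w : Fin 1 → M | ∃ z, z ∈ ({e} : Set M) ∧ z < w 0} :=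
    definable_exists (definable_and (definable_mem he _) (definable_lt _ _))
  simp only [mem_singleton_iff, exists_eq_left] at this
  exact this

theorem definable₁_Iio {e : M} (he : e ∈ dcl L A) : A.Definable₁ L {y | y < e} := by
  have : A.Definable L {w : Fin 1 → M | ∃ z, z ∈ ({e} : Set M) ∧ w 0 < z} :=
    definable_exists (definable_and (definable_mem he _) (definable_lt _ _))
  simp only [mem_singleton_iff, exists_eq_left] at this
  exact this

/-- Suppose only finitely many realizations of the type of `b` over `∅` are definable over `A`.
Then there is an `A`-definable set `Λ` containing `b` which, together with the type of `b` over
`∅`, implies the type of `b` over `A`. If `b` is not definable over `A`, then `Λ` records the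
position of `b` relative to those finitely many realizations. -/
theorem IsOMinimalStructure.exists_isolating (hM : IsOMinimalStructure L M) (b : M)
    (hfin : {e ∈ dcl L A | ∀ P, (∅ : Set M).Definable₁ L P → b ∈ P → e ∈ P}.Finite) :
    ∃ Λ, A.Definable₁ L Λ ∧ b ∈ Λ ∧ ∀ S, A.Definable₁ L S → b ∈ S →
      ∃ P, (∅ : Set M).Definable₁ L P ∧ b ∈ P ∧ P ∩ Λ ⊆ S := by
  classical
  by_cases hb : b ∈ dcl L A
  · refine ⟨{b}, hb, rfl, fun S _ hbS => ⟨univ, Set.definable_univ, mem_univ b, ?_⟩⟩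
    rintro y ⟨-, rfl⟩
    exact hbS
  set D := {e ∈ dcl L A | ∀ P, (∅ : Set M).Definable₁ L P → b ∈ P → e ∈ P} with hD
  have hne : ∀ e ∈ dcl L A, e ≠ b := fun e he h => hb (h ▸ he)
  let Λ : Set M := ⋂ e : D, if (e : M) < b then {y | (e : M) < y} else {y | y < (e : M)}
  have hΛ : ∀ e ∈ D, ∀ y ∈ Λ, (e < b → e < y) ∧ (b < e → y < e) := by
    intro e he y hy
    have h := mem_iInter.1 hy ⟨e, he⟩
    constructor
    · intro h1
      simpa [h1] using h
    · intro h1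
      simpa [h1.not_gt] using h
  -- points definable over `A` are separated from `b` on `Λ`, modulo the type of `b`
  have hsep : ∀ e ∈ dcl L A, ∃ P, (∅ : Set M).Definable₁ L P ∧ b ∈ P ∧
      ∀ y, y ∈ P → y ∈ Λ → (e < b → e < y) ∧ (b < e → y < e) := by
    intro e he
    by_cases heD : e ∈ D
    · exact ⟨univ, Set.definable_univ, mem_univ b, fun y _ hy => hΛ e heD y hy⟩
    · obtain ⟨P, hP, hbP, heP⟩ : ∃ P, (∅ : Set M).Definable₁ L P ∧ b ∈ P ∧ e ∉ P := by
        by_contra! h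
        exact heD ⟨he, h⟩
      obtain ⟨C, hC, hCc, hbC, hCP⟩ := hM.exists_ordConnected hP hbP
      refine ⟨C, hC, hbC, fun y hy _ => ⟨fun h => ?_, fun h => ?_⟩⟩
      · by_contra hy'
        exact heP (hCP (hCc.out hy hbC ⟨not_lt.1 hy', h.le⟩))
      · by_contra hy'
        exact heP (hCP (hCc.out hbC hy ⟨h.le, not_lt.1 hy'⟩))
  -- hence so is every initial segment definable over `A`
  have hlower : ∀ I, A.Definable₁ L I → IsLowerSet I → ∃ P, (∅ : Set M).Definable₁ L P ∧ b ∈ P ∧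
      ∀ y, y ∈ P → y ∈ Λ → (y ∈ I ↔ b ∈ I) := by
    intro I hI hlow
    rcases hM.lowerSet_eq hI hlow with rfl | rfl | ⟨e, he, h⟩
    · exact ⟨univ, Set.definable_univ, mem_univ b, fun y _ _ => by simp⟩
    · exact ⟨univ, Set.definable_univ, mem_univ b, fun y _ _ => by simp⟩
    · obtain ⟨P, hP, hbP, hy⟩ := hsep e he
      refine ⟨P, hP, hbP, fun y hyP hyΛ => ?_⟩
      obtain ⟨h1, h2⟩ := hy y hyP hyΛ
      rcases (hne e he).lt_or_gt with hlt | hlt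
      · rcases h with rfl | rfl
        · exact iff_of_false (not_le.2 (h1 hlt)) (not_le.2 hlt)
        · exact iff_of_false (not_lt.2 (h1 hlt).le) (not_lt.2 hlt.le)
      · rcases h with rfl | rfl
        · exact iff_of_true (h2 hlt).le hlt.le
        · exact iff_of_true (h2 hlt) hlt
  refine ⟨Λ, ?_, ?_, ?_⟩
  · have : Finite D := hfin.to_subtype
    have h : A.Definable L (⋂ e : D, {w : Fin 1 → M | w 0 ∈
        (if (e : M) < b then {y | (e : M) < y} else {y | y < (e : M)} : Set M)}) := by
      refine Set.definable_iInter_of_finite fun e => ?_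
      refine definable_mem (L := L) (A := A) ?_ (0 : Fin 1)
      split_ifs
      · exact definable₁_Ioi e.2.1
      · exact definable₁_Iio e.2.1
    have hΛe : {w : Fin 1 → M | w 0 ∈ Λ} = ⋂ e : D, {w : Fin 1 → M | w 0 ∈
        (if (e : M) < b then {y | (e : M) < y} else {y | y < (e : M)} : Set M)} := by
      ext w
      simp [Λ]
    change A.Definable L {w : Fin 1 → M | w 0 ∈ Λ}
    rw [hΛe]
    exact h
  · refine mem_iInter.2 fun e => ?_
    split_ifs with h
    · exact h
    · exact lt_of_le_of_ne (not_lt.1 h) (hne e e.2.1).symm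
  · intro S hS hbS
    obtain ⟨C, hC, hCc, hbC, hCS⟩ := hM.exists_ordConnected hS hbS
    -- the initial segments below `C` and up to `C`
    obtain ⟨P, hP, hbP, h1⟩ := hlower {y | ∀ z, z ∈ C → y < z}
      (definable_forall (definable_imp (definable_mem hC _) (definable_lt _ _)))
      (fun x y h hx z hz => h.trans_lt (hx z hz))
    obtain ⟨P', hP', hbP', h2⟩ := hlower {y | ∃ z, z ∈ C ∧ y ≤ z}
      (definable_exists (definable_and (definable_mem hC _) (definable_le _ _)))
      (fun x y h ⟨z, hz, hx⟩ => ⟨z, hz, h.trans hx⟩)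
    refine ⟨P ∩ P', Set.Definable.inter hP hP', ⟨hbP, hbP'⟩, ?_⟩
    rintro y ⟨⟨hyP, hyP'⟩, hyΛ⟩
    have h3 : ¬ ∀ z, z ∈ C → y < z := fun h => lt_irrefl b ((h1 y hyP hyΛ).1 h b hbC)
    push Not at h3
    obtain ⟨z, hz, hzy⟩ := h3
    obtain ⟨z', hz', hyz'⟩ := (h2 y hyP' hyΛ).2 ⟨b, hbC, le_rfl⟩
    exact hCS (hCc.out hz hz' ⟨hzy, hyz'⟩)

end Isolation

/-- Sets definable over the entries of a tuple are the sections of formulas. -/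
theorem exists_formula_of_definable₁_range {n : ℕ} {a : Fin n → M} {S : Set M}
    (hS : (range a).Definable₁ L S) :
    ∃ φ : L.Formula (Fin (n + 1)),
      ∀ y, φ.Realize (Fin.snoc a y : Fin (n + 1) → M) ↔ y ∈ S := by
  obtain ⟨φ, hφ⟩ := Set.definable_iff_exists_formula_sum.1 hS
  let g : range a ⊕ Fin 1 → Fin (n + 1) :=
    Sum.elim (fun x => (Classical.choose x.2).castSucc) (fun _ => Fin.last n)
  refine ⟨φ.relabel g, fun y => ?_⟩
  have h1 : (fun _ : Fin 1 => y) ∈ {x : Fin 1 → M | x 0 ∈ S} ↔ y ∈ S := Iff.rfl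
  rw [← h1, hφ, Language.Formula.realize_relabel, mem_ofPred_eq]
  refine iff_of_eq (congrArg _ ?_)
  funext s
  rcases s with x | i
  · simp only [g, Function.comp_apply, Sum.elim_inl, Fin.snoc_castSucc]
    exact Classical.choose_spec x.2
  · simp [g]

/-! ### Counting types -/

section Types

variable {T : L.Theory}

theorem typeOf_eq_iff {α : Type*} {M N : Type*} [L.Structure M] [Nonempty M] [M ⊨ T]
    [L.Structure N] [Nonempty N] [N ⊨ T] {a : α → M} {b : α → N} :
    T.typeOf a = T.typeOf b ↔ ∀ φ : L.Formula α, φ.Realize a ↔ φ.Realize b := by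
  constructor
  · intro h φ
    rw [← Language.Theory.CompleteType.formula_mem_typeOf (T := T), h,
      Language.Theory.CompleteType.formula_mem_typeOf]
  · intro h
    refine SetLike.ext fun φ => ?_
    rw [Language.Theory.CompleteType.mem_typeOf, Language.Theory.CompleteType.mem_typeOf]
    exact h _

theorem exists_realization {n : ℕ} (q : Types T n) :
    ∃ (M : Language.Theory.ModelType.{u, v, max u v} T) (a : Fin n → M), T.typeOf a = q := by
  obtain ⟨M, a, h⟩ := Language.Theory.exists_modelType_is_realized_in T q
  exact ⟨M, a, h⟩

theorem IsOMinimalTheory.exists_linearOrder [L.IsOrdered] (hT : IsOMinimalTheory T)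
    (M : Language.Theory.ModelType.{u, v, max u v} T) :
    ∃ _ : LinearOrder M, L.OrderedStructure M ∧ IsOMinimalStructure L M := by
  classical
  have : M ⊨ L.linearOrderTheory :=
    (Language.Theory.model_iff _).2 fun φ hφ => (hT.linearOrder φ hφ).realize_sentence M
  let o : LinearOrder M := L.linearOrderOfModels M
  have ho : L.OrderedStructure M := inferInstance
  exact ⟨o, ho, hT.oMinimal M⟩

/-- Realizations of a simple type are independent as soon as there are two of them; so, by
exchange, only finitely many of them are definable over a finite set. -/
theorem IsSimple.finite_dcl_inter {p : Types T 1} (hp : IsSimple p)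
    (M : Language.Theory.ModelType.{u, v, max u v} T) [LinearOrder M] [L.IsOrdered]
    [L.OrderedStructure M] (hM : IsOMinimalStructure L M) {A : Set M} (hA : A.Finite) :
    (dcl L A ∩ realizations p M).Finite := by
  classical
  by_contra hinf
  obtain ⟨B, hB, hcard⟩ := Set.Infinite.exists_subset_card_eq hinf (hA.toFinset.card + 2)
  have := card_le_of_exchange hM.exchange hA.toFinset ∅ B ?_ ?_
  · omega
  · intro b hb
    simpa using (hB hb).1
  · intro b hb hbd
    rw [empty_union] at hbd
    have hne : ((B : Set M) \ {b}).Nonempty := by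
      have : (B.erase b).Nonempty := by
        rw [← Finset.card_pos, Finset.card_erase_of_mem hb]
        omega
      exact Finset.coe_erase b B ▸ Finset.coe_nonempty.2 this
    have hcl := hp M ((B : Set M) \ {b}) hne (fun x hx => (hB hx.1).2)
    have : b ∈ clType p ((B : Set M) \ {b}) := ⟨(hB hb).2, hbd⟩
    rw [hcl] at this
    exact this.2 rfl

/-- `φ` isolates the type of `v` modulo the types of its initial part and of its last entry:
in the presence of these types, every formula true of `v` follows from `φ`. -/
def Isolates {n : ℕ} (φ : L.Formula (Fin (n + 1))) (v : Fin (n + 1) → M) : Prop :=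
  φ.Realize v ∧ ∀ θ : L.Formula (Fin (n + 1)), θ.Realize v →
    ∃ π : L.Formula (Fin 1), π.Realize (fun _ => v (Fin.last n)) ∧
      ∀ y, π.Realize (fun _ => y) → φ.Realize (Fin.snoc (Fin.init v) y : Fin (n + 1) → M) →
        θ.Realize (Fin.snoc (Fin.init v) y : Fin (n + 1) → M)

theorem IsOMinimalTheory.exists_isolates [L.IsOrdered] (hT : IsOMinimalTheory T)
    (hsimple : ∀ p : Types T 1, IsSimple p) (M : Language.Theory.ModelType.{u, v, max u v} T)
    {n : ℕ} (v : Fin (n + 1) → M) : ∃ φ : L.Formula (Fin (n + 1)), Isolates φ v := by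
  obtain ⟨_, _, hM⟩ := hT.exists_linearOrder M
  have hv : (Fin.snoc (Fin.init v) (v (Fin.last n)) : Fin (n + 1) → M) = v :=
    Fin.snoc_init_self v
  obtain ⟨Λ, hΛ, hbΛ, hS⟩ := hM.exists_isolating (A := range (Fin.init v)) (v (Fin.last n)) (by
    refine ((hsimple (T.typeOf fun _ => v (Fin.last n))).finite_dcl_inter M hM
      (finite_range (Fin.init v))).subset fun e he => ⟨he.1, ?_⟩
    have hφ : ∀ φ : L.Formula (Fin 1), φ.Realize (fun _ => v (Fin.last n)) →
        φ.Realize (fun _ => e) := by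
      intro φ h
      refine he.2 {y | φ.Realize fun _ => y} (Set.empty_definable_iff.2 ⟨φ, ?_⟩) h
      ext w
      have : w = fun _ => w 0 := funext fun i => by rw [Subsingleton.elim i 0]
      rw [this]
      rfl
    refine typeOf_eq_iff.2 fun φ => ⟨fun h => ?_, hφ φ⟩
    by_contra h'
    exact hφ φ.not h' h)
  obtain ⟨φ, hφ⟩ := exists_formula_of_definable₁_range hΛ
  refine ⟨φ, hv ▸ (hφ _).2 hbΛ, fun θ hθ => ?_⟩
  obtain ⟨P, hP, hbP, hPS⟩ := hS {y | θ.Realize (Fin.snoc (Fin.init v) y : Fin (n + 1) → M)} (by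
      let g : Fin (n + 1) → range (Fin.init v) ⊕ Fin 1 :=
        Fin.lastCases (Sum.inr 0) (fun i => Sum.inl ⟨Fin.init v i, mem_range_self i⟩)
      refine Set.definable_iff_exists_formula_sum.2 ⟨θ.relabel g, ?_⟩
      ext w
      refine Iff.trans ?_ Language.Formula.realize_relabel.symm
      refine iff_of_eq (congrArg θ.Realize ?_)
      funext i
      refine Fin.lastCases ?_ (fun i => ?_) i <;> simp [g])
    (by rw [mem_ofPred_eq, hv]; exact hθ)
  obtain ⟨π, hπ⟩ := Set.empty_definable_iff.1 hP
  have hπ' : ∀ y, π.Realize (fun _ => y) ↔ y ∈ P := by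
    intro y
    have : (fun _ : Fin 1 => y) ∈ {x : Fin 1 → M | x 0 ∈ P} ↔ y ∈ P := Iff.rfl
    rw [← this, hπ]
    rfl
  exact ⟨π, (hπ' _).2 hbP, fun y hy hyφ => hPS ⟨(hπ' y).1 hy, (hφ y).1 hyφ⟩⟩

/-- The formula in `x` saying that `π y` and `φ (x, y)` imply `θ (x, y)` for all `y`. -/
noncomputable def forallImp {n : ℕ} (π : L.Formula (Fin 1)) (φ θ : L.Formula (Fin (n + 1))) :
    L.Formula (Fin n) :=
  Language.Formula.iAlls (Fin 1) ((π.relabel Sum.inr).imp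
    ((φ.relabel (Fin.lastCases (Sum.inr 0) Sum.inl)).imp
      (θ.relabel (Fin.lastCases (Sum.inr 0) Sum.inl))))

theorem realize_forallImp {n : ℕ} (π : L.Formula (Fin 1)) (φ θ : L.Formula (Fin (n + 1)))
    (a : Fin n → M) : (forallImp π φ θ).Realize a ↔ ∀ y : M, π.Realize (fun _ => y) →
      φ.Realize (Fin.snoc a y : Fin (n + 1) → M) →
        θ.Realize (Fin.snoc a y : Fin (n + 1) → M) := by
  have hg : ∀ u : Fin 1 → M, (Sum.elim a u) ∘
      (Fin.lastCases (Sum.inr 0) Sum.inl : Fin (n + 1) → Fin n ⊕ Fin 1)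
        = (Fin.snoc a (u 0) : Fin (n + 1) → M) := by
    intro u
    funext i
    refine Fin.lastCases ?_ (fun i => ?_) i <;> simp
  simp only [forallImp, Language.Formula.realize_iAlls, Language.Formula.realize_imp,
    Language.Formula.realize_relabel, hg, Sum.elim_comp_inr]
  constructor
  · intro h y
    exact h fun _ => y
  · intro h u
    have : u = fun _ => u 0 := funext fun i => by rw [Subsingleton.elim i 0]
    rw [this]
    exact h (u 0)

/-- Isolation transfers to other models: whether `π y` and `φ (x, y)` imply `θ (x, y)` depends only
on the type of `x`. -/
theorem Isolates.realize {N : Type*} [L.Structure N] [Nonempty M] [M ⊨ T] [Nonempty N] [N ⊨ T]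
    {n : ℕ} {φ : L.Formula (Fin (n + 1))} {v : Fin (n + 1) → M} (h : Isolates φ v)
    {v' : Fin (n + 1) → N} (hφ : φ.Realize v')
    (hinit : T.typeOf (Fin.init v : Fin n → M) = T.typeOf (Fin.init v' : Fin n → N))
    (hlast : T.typeOf (fun _ : Fin 1 => v (Fin.last n))
      = T.typeOf (fun _ : Fin 1 => v' (Fin.last n)))
    {θ : L.Formula (Fin (n + 1))} (hθ : θ.Realize v) : θ.Realize v' := by
  obtain ⟨π, hπ, himp⟩ := h.2 θ hθ
  have h1 := (realize_forallImp π φ θ _).1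
    ((typeOf_eq_iff.1 hinit _).1 ((realize_forallImp π φ θ _).2 himp))
    (v' (Fin.last n)) ((typeOf_eq_iff.1 hlast π).1 hπ)
  have hv' : (Fin.snoc (Fin.init v' : Fin n → N) (v' (Fin.last n)) : Fin (n + 1) → N) = v' :=
    Fin.snoc_init_self v'
  rw [hv'] at h1
  exact h1 hφ

/-- In the simple case, a type in `n + 1` variables is determined by the types of its initial part
and of its last entry, together with one formula. -/
theorem IsOMinimalTheory.countable_types_succ [L.IsOrdered] [Countable L.Symbols]
    (hT : IsOMinimalTheory T) (hsimple : ∀ p : Types T 1, IsSimple p) {n : ℕ}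
    (h1 : Countable (Types T 1)) (hn : Countable (Types T n)) : Countable (Types T (n + 1)) := by
  choose M v hv using fun q : Types T (n + 1) => exists_realization q
  choose φ hφ using fun q => hT.exists_isolates hsimple (M q) (v q)
  let f : Types T (n + 1) → Types T n × Types T 1 × L.Formula (Fin (n + 1)) := fun q =>
    (T.typeOf (Fin.init (v q) : Fin n → M q), T.typeOf (fun _ => v q (Fin.last n)), φ q)
  have key : ∀ q q', f q = f q' → ∀ θ : L.Formula (Fin (n + 1)), θ.Realize (v q) → θ.Realize (v q') := by
    intro q q' h θ hθ
    obtain ⟨h1, h2⟩ := Prod.mk.inj h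
    obtain ⟨h2, h3⟩ := Prod.mk.inj h2
    exact (hφ q).realize (h3 ▸ (hφ q').1) h1 h2 hθ
  refine Function.Injective.countable (f := f) fun q q' h => ?_
  rw [← hv q, ← hv q', typeOf_eq_iff]
  exact fun θ => ⟨key q q' h θ, key q' q h.symm θ⟩

/-- A type in no variables is determined by the type of any element of a model of it. -/
theorem countable_types_zero (h1 : Countable (Types T 1)) : Countable (Types T 0) := by
  choose M v hv using fun q : Types T 0 => exists_realization q
  refine Function.Injective.countable (β := Types T 1)
    (f := fun q => T.typeOf fun _ => Classical.arbitrary (M q)) fun q q' h => ?_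
  rw [← hv q, ← hv q', typeOf_eq_iff]
  intro φ
  have := typeOf_eq_iff.1 h (φ.relabel Fin.elim0)
  rw [Language.Formula.realize_relabel, Language.Formula.realize_relabel] at this
  convert this using 2

end Types

end OMin

theorem mainTheorem5 (L : FirstOrder.Language.{u, v}) [L.IsOrdered] [Countable L.Symbols]
    (T : L.Theory) (hcomplete : T.IsComplete) (homin : OMin.IsOMinimalTheory T)
    (hsimple : ¬ OMin.AdmitsNonsimpleType T) :
    OMin.IsSmall T ↔ Countable (OMin.Types T 1) := by
  refine ⟨fun h => h 1, fun h1 n => ?_⟩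
  have hs : ∀ p : OMin.Types T 1, OMin.IsSimple p := fun p => by
    by_contra hp
    exact hsimple ⟨p, hp⟩
  induction n with
  | zero => exact OMin.countable_types_zero h1
  | succ n ih => exact homin.countable_types_succ hs h1 ih
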